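/- Let $H\subset S(n)$ be an arbitrary subgroup and let $\varphi^{\alpha}$ be pairwise inequivalent irreducible unitary matrix representations (irreps) of $H$, of dimensions $d_\alpha$. Let $\phi^{\mu}_R$ be pairwise inequivalent irreducible unitary matrix representations of $S(n)$, of dimensions $d_\mu$, in partially reduced (PRIR) form with respect to $H$: for every $\mu$ and $\alpha$ there is a finite set $\mathcal R_{\mu/\alpha}$ of labels $r_{\mu/\alpha}$ of the copies of $\varphi^\alpha$ in $\phi^\mu$ (for $H=S(n-k)$, the paths from $\mu$ to $\alpha$ on Young's lattice), the basis of $\phi_R^\mu$ is indexed by the pairs $(r_{\mu/\alpha},i_\alpha)$ with $r_{\mu/\alpha}\in\mathcal R_{\mu/\alpha}$ and $1\le i_\alpha\le d_\alpha$, and on $H$ the matrices are block diagonal, $$(\phi_R^\mu)^{r_{\mu/\alpha},\tilde r_{\mu/\beta}}_{i_\alpha\ j_\beta}(\varkappa)=\delta^{r_{\mu/\alpha}\tilde r_{\mu/\beta}}\,\varphi^\alpha_{i_\alpha j_\alpha}(\varkappa)\qquad(\varkappa\in H).$$ A delta $\delta^{r_{\mu/\alpha}\tilde r_{\nu/\beta}}$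 of two labels is $1$ if $\mu=\nu$, $\alpha=\beta$ and the labels coincide, and $0$ otherwise. Let $T=\{\tau_k : k=1,\dots,n!/|H|\}$ be a transversal of $H$ with $S(n)=\bigsqcup_k H\tau_k$. Then for all irreps $\mu,\nu$ of $S(n)$, all irreps $\alpha,\beta,\gamma$ of $H$, all labels $r_{\mu/\alpha},\tilde r_{\mu/\beta},r_{\nu/\beta},\tilde r_{\nu/\gamma}$ and all indices $1\le i_\alpha\le d_\alpha$, $1\le j_\gamma\le d_\gamma$, $$\sum_{k=1}^{n!/|H|}\ \sum_{k_\beta=1}^{d_\beta}(\phi_R^\mu)^{r_{\mu/\alpha},\tilde r_{\mu/\beta}}_{i_\alpha\ k_\beta}(\tau_k^{-1})\,(\phi_R^\nu)^{r_{\nu/\beta},\tilde r_{\nu/\gamma}}_{k_\beta\ j_\gamma}(\tau_k)=\frac{n!}{|H|}\,\frac{d_\beta}{d_\mu}\,\delta^{\tilde r_{\mu/\beta}r_{\nu/\beta}}\,\delta^{r_{\mu/\alpha}\tilde r_{\nu/\gamma}}\,\delta_{i_\alpha j_\gamma}.$$ If instead $S(n)=\bigsqcup_k\tau_kH$, the same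 identity holds with $\tau_k$ and $\tau_k^{-1}$ interchanged on the left-hand side. -/

import Mathlib

/-- The linear representation on `ι → ℂ` given by a unitary matrix representation of `G`. -/
noncomputable def matrixRep {G ι : Type*} [Group G] [Fintype ι] [DecidableEq ι]
    (φ : G →* Matrix.unitaryGroup ι ℂ) : Representation ℂ G (ι → ℂ) where
  toFun g := Matrix.toLin' (φ g : Matrix ι ι ℂ)
  map_one' := by simp; rfl
  map_mul' g h := by simp [Matrix.toLin'_mul]; rfl

/-- A family of unitary matrix representations of `G` consisting of pairwise inequivalent
irreducible representations, so that its labels are types of irreps of `G`. -/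
structure IsIrrepFamily {G M : Type*} {ι : M → Type*} [Group G]
    [∀ μ, Fintype (ι μ)] [∀ μ, DecidableEq (ι μ)]
    (φ : ∀ μ, G →* Matrix.unitaryGroup (ι μ) ℂ) : Prop where
  irreducible : ∀ μ, (matrixRep (φ μ)).IsIrreducible
  inequivalent : ∀ μ ν, μ ≠ ν → IsEmpty ((matrixRep (φ μ)).Equiv (matrixRep (φ ν)))

/-- For a fixed irrep `μ` of the big group, `R α` is the set of labels `r_{μ/α}` of the copies of
the irrep `α` of the subgroup in `μ` (the paths from `μ` to `α`). A basis index is a pair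
`(r_{μ/α}, l_α)` with `l_α` an index of the irrep `α`, which has dimension `d α`. -/
abbrev PRIRIndex {A : Type*} (d : A → ℕ) (R : A → Type*) : Type _ :=
  Σ r : (Σ α, R α), Fin (d r.1)

/-- The unitary matrix representation `Φ` of `G` is partially reduced with respect to `H` and to
the irreps `χ α` of `H`: on `H` it is block diagonal, the block at `r_{μ/α}` being `χ α`. -/
def IsPRIR {G A : Type*} [Group G] [Fintype A] [DecidableEq A] (H : Subgroup G) {d : A → ℕ}
    (χ : ∀ α, H →* Matrix.unitaryGroup (Fin (d α)) ℂ)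
    {R : A → Type*} [∀ α, Fintype (R α)] [∀ α, DecidableEq (R α)]
    (Φ : G →* Matrix.unitaryGroup (PRIRIndex d R) ℂ) : Prop :=
  ∀ h : H, (Φ (h : G) : Matrix (PRIRIndex d R) (PRIRIndex d R) ℂ) =
    Matrix.blockDiagonal' fun r : (Σ α, R α) =>
      (χ r.1 h : Matrix (Fin (d r.1)) (Fin (d r.1)) ℂ)

/-! Over the whole group, Schur orthogonality evaluates the sum over `g` of products of entries of
`φ μ g⁻¹` and `φ ν g`. Summing in addition over the inner index `k` of a block `β` makes the summand
constant on each coset `H g`: block diagonality puts `χ β h⁻¹` and `χ β h` side by side, and they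
cancel (`IsPRIR.sum_mul_left_invariant`). Hence the group sum is `|H|` times the transversal sum,
and the `d β` values of `k` contribute equally, giving the factor `d β`. -/

/-- The sum over `g` of `φ g⁻¹ * X * ψ g`, which intertwines `ψ` and `φ`. -/
noncomputable def intertwiningSum {G ι κ : Type*} [Group G] [Fintype G]
    [Fintype ι] [DecidableEq ι] [Fintype κ] [DecidableEq κ]
    (φ : G →* Matrix.unitaryGroup ι ℂ) (ψ : G →* Matrix.unitaryGroup κ ℂ)
    (X : Matrix ι κ ℂ) : Matrix ι κ ℂ :=
  ∑ g : G, (φ g⁻¹ : Matrix ι ι ℂ) * X * (ψ g : Matrix κ κ ℂ)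

/-- In dimension zero there is only one subrepresentation, while irreducibility demands two. This
permits division by the dimension. -/
theorem card_ne_zero_of_isIrreducible {G ι : Type*} [Group G] [Fintype ι] [DecidableEq ι]
    {φ : G →* Matrix.unitaryGroup ι ℂ} (hφ : (matrixRep φ).IsIrreducible) :
    (Fintype.card ι : ℂ) ≠ 0 := by
  rw [Nat.cast_ne_zero]
  intro h
  have := Fintype.card_eq_zero_iff.1 h
  have := hφ.toNontrivial
  obtain ⟨U, V, hUV⟩ := this
  refine hUV (SetLike.ext fun x => ?_)
  rw [Subsingleton.elim x 0]
  exact iff_of_true U.toSubmodule.zero_mem V.toSubmodule.zero_mem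

section Schur

variable {G ι κ : Type*} [Group G] [Fintype G]
    [Fintype ι] [DecidableEq ι] [Fintype κ] [DecidableEq κ]
    (φ : G →* Matrix.unitaryGroup ι ℂ) (ψ : G →* Matrix.unitaryGroup κ ℂ)

theorem intertwiningSum_mul (X : Matrix ι κ ℂ) (h : G) :
    intertwiningSum φ ψ X * (ψ h : Matrix κ κ ℂ) =
      (φ h : Matrix ι ι ℂ) * intertwiningSum φ ψ X := by
  unfold intertwiningSum
  rw [Matrix.sum_mul, Matrix.mul_sum]
  refine Fintype.sum_equiv (Equiv.mulRight h) _ _ fun g => ?_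
  have hg : φ g⁻¹ = φ h * φ (g * h)⁻¹ := by rw [← map_mul]; simp
  rw [Equiv.coe_mulRight, hg, map_mul ψ]
  simp only [Submonoid.coe_mul, Matrix.mul_assoc]

/-- The intertwining map with matrix `intertwiningSum φ ψ X`. -/
noncomputable def intertwiningSumMap (X : Matrix ι κ ℂ) :
    (matrixRep ψ).IntertwiningMap (matrixRep φ) where
  toLinearMap := Matrix.toLin' (intertwiningSum φ ψ X)
  isIntertwining' h := by
    change Matrix.toLin' _ ∘ₗ Matrix.toLin' _ = Matrix.toLin' _ ∘ₗ Matrix.toLin' _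
    rw [← Matrix.toLin'_mul, ← Matrix.toLin'_mul, intertwiningSum_mul]

theorem intertwiningSum_single_apply (a b : ι) (c e : κ) :
    intertwiningSum φ ψ (Matrix.single b c 1) a e =
      ∑ g : G, (φ g⁻¹ : Matrix ι ι ℂ) a b * (ψ g : Matrix κ κ ℂ) c e := by
  simp only [intertwiningSum, Matrix.sum_apply]
  refine Finset.sum_congr rfl fun g _ => ?_
  rw [Matrix.mul_apply, Finset.sum_eq_single c]
  · simp
  · intro x _ hx
    simp [hx]
  · simp

variable {φ ψ}

theorem sum_mul_eq_zero_of_inequivalent (hφ : (matrixRep φ).IsIrreducible)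
    (hψ : (matrixRep ψ).IsIrreducible) (h : IsEmpty ((matrixRep ψ).Equiv (matrixRep φ)))
    (a b : ι) (c e : κ) :
    ∑ g : G, (φ g⁻¹ : Matrix ι ι ℂ) a b * (ψ g : Matrix κ κ ℂ) c e = 0 := by
  -- Schur's lemma: there are no nonzero intertwining maps between inequivalent irreps.
  have h0 : intertwiningSumMap φ ψ (Matrix.single b c 1) = 0 := Subsingleton.elim _ _
  have h1 : Matrix.toLin' (intertwiningSum φ ψ (Matrix.single b c 1)) = 0 :=
    congrArg (fun f => f.toLinearMap) h0
  rw [LinearEquiv.map_eq_zero_iff] at h1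
  rw [← intertwiningSum_single_apply, h1, Matrix.zero_apply]

/-- By Schur's lemma over `ℂ` the averaged matrix unit is a scalar `t`. Conjugation preserves the
trace, so comparing traces determines `t`. -/
theorem sum_mul_eq_of_isIrreducible (hφ : (matrixRep φ).IsIrreducible) (a b c e : ι) :
    ∑ g : G, (φ g⁻¹ : Matrix ι ι ℂ) a b * (φ g : Matrix ι ι ℂ) c e =
      (Fintype.card G : ℂ) / (Fintype.card ι : ℂ) *
        (if b = c then 1 else 0) * (if a = e then 1 else 0) := by
  set X : Matrix ι ι ℂ := Matrix.single b c 1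
  obtain ⟨t, ht⟩ := (Representation.IsIrreducible.algebraMap_intertwiningMap_bijective_of_isAlgClosed
    (ρ := matrixRep φ)).2 (intertwiningSumMap φ φ X)
  have h1 : Matrix.toLin' (intertwiningSum φ φ X) = Matrix.toLin' (t • (1 : Matrix ι ι ℂ)) := by
    rw [map_smul, Matrix.toLin'_one]
    exact (congrArg (fun f => f.toLinearMap) ht).symm
  have h2 : intertwiningSum φ φ X = t • 1 := Matrix.toLin'.injective h1
  have h3 : (intertwiningSum φ φ X).trace = (Fintype.card G : ℂ) * (if b = c then 1 else 0) := by
    have key : ∀ g : G, ((φ g⁻¹ : Matrix ι ι ℂ) * X * (φ g : Matrix ι ι ℂ)).trace =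
        if b = c then 1 else 0 := by
      intro g
      rw [Matrix.trace_mul_comm, ← Matrix.mul_assoc, ← Submonoid.coe_mul, ← map_mul,
        mul_inv_cancel, map_one, Submonoid.coe_one, Matrix.one_mul]
      split_ifs with hbc
      · subst hbc
        exact Matrix.trace_single_eq_same _ _
      · exact Matrix.trace_single_eq_of_ne _ _ _ hbc
    rw [intertwiningSum, Matrix.trace_sum, Finset.sum_congr rfl fun g _ => key g]
    simp
  rw [h2, Matrix.trace_smul, Matrix.trace_one, smul_eq_mul] at h3
  have hc := card_ne_zero_of_isIrreducible hφ
  rw [← intertwiningSum_single_apply]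
  change intertwiningSum φ φ X a e = _
  rw [h2, Matrix.smul_apply, Matrix.one_apply, smul_eq_mul, div_mul_eq_mul_div, ← h3,
    mul_div_cancel_right₀ _ hc]

end Schur

/-- Schur orthogonality of the matrix elements of a family of irreps. -/
theorem IsIrrepFamily.sum_mul {G M : Type*} {ι : M → Type*} [Group G] [Fintype G]
    [∀ μ, Fintype (ι μ)] [∀ μ, DecidableEq (ι μ)] [DecidableEq M]
    {φ : ∀ μ, G →* Matrix.unitaryGroup (ι μ) ℂ} (hφ : IsIrrepFamily φ) {μ ν : M}
    (a b : ι μ) (c e : ι ν) :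
    ∑ g : G, (φ μ g⁻¹ : Matrix (ι μ) (ι μ) ℂ) a b * (φ ν g : Matrix (ι ν) (ι ν) ℂ) c e =
      (Fintype.card G : ℂ) / (Fintype.card (ι μ) : ℂ) *
        (if (⟨μ, b⟩ : Σ μ, ι μ) = ⟨ν, c⟩ then 1 else 0) *
        (if (⟨μ, a⟩ : Σ μ, ι μ) = ⟨ν, e⟩ then 1 else 0) := by
  by_cases h : μ = ν
  · subst h
    rw [sum_mul_eq_of_isIrreducible (hφ.irreducible μ)]
    simp
  · rw [sum_mul_eq_zero_of_inequivalent (hφ.irreducible μ) (hφ.irreducible ν)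
      (hφ.inequivalent ν μ (Ne.symm h))]
    simp [h]

/-- Each `g` factors uniquely as `h * τ`, and `f` does not see `h`. -/
theorem Subgroup.IsComplement.card_mul_sum {G : Type*} [Group G] [Fintype G] {H : Subgroup G}
    {T : Finset G} (hT : Subgroup.IsComplement (H : Set G) (T : Set G)) {f : G → ℂ}
    (hf : ∀ h ∈ H, ∀ g, f (h * g) = f g) :
    (Nat.card H : ℂ) * ∑ τ ∈ T, f τ = ∑ g, f g := by
  classical
  rw [← hT.equiv.symm.sum_comp, Fintype.sum_prod_type]
  simp only [Subgroup.IsComplement.equiv_symm_apply]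
  rw [Finset.sum_congr rfl fun (h : (H : Set G)) _ =>
    Finset.sum_congr rfl fun (t : (T : Set G)) _ => hf h h.2 t, Finset.sum_const,
    Finset.card_univ, nsmul_eq_mul, ← Nat.card_eq_fintype_card]
  congr 1
  exact (Finset.sum_coe_sort T f).symm

theorem Subgroup.IsComplement.inv {G : Type*} [Group G] {S T : Set G}
    (h : Subgroup.IsComplement S T) : Subgroup.IsComplement T⁻¹ S⁻¹ := by
  rw [Subgroup.isComplement_iff_existsUnique] at h ⊢
  intro g
  obtain ⟨x, hx, hu⟩ := h g⁻¹
  refine ⟨⟨⟨(x.2 : G)⁻¹, by simp⟩, ⟨(x.1 : G)⁻¹, by simp⟩⟩, ?_, fun y hy => ?_⟩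
  · simp only at hx ⊢
    rw [← mul_inv_rev, hx, inv_inv]
  · have := hu ⟨⟨(y.2 : G)⁻¹, y.2.2⟩, ⟨(y.1 : G)⁻¹, y.1.2⟩⟩ (by
      simp only at hy ⊢
      rw [← mul_inv_rev, hy])
    rw [← this]
    simp

section PRIR

variable {G A : Type*} [Group G] [Fintype A] [DecidableEq A] {H : Subgroup G} {d : A → ℕ}
    {χ : ∀ α, H →* Matrix.unitaryGroup (Fin (d α)) ℂ}
    {R : A → Type*} [∀ α, Fintype (R α)] [∀ α, DecidableEq (R α)]
    {Φ : G →* Matrix.unitaryGroup (PRIRIndex d R) ℂ}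

theorem IsPRIR.apply_mul (hΦ : IsPRIR H χ Φ) (h : H) (g : G) (p : Σ α, R α) (k : Fin (d p.1))
    (c : PRIRIndex d R) :
    (Φ (h * g) : Matrix (PRIRIndex d R) (PRIRIndex d R) ℂ) ⟨p, k⟩ c =
      ∑ l, (χ p.1 h : Matrix _ _ ℂ) k l *
        (Φ g : Matrix (PRIRIndex d R) (PRIRIndex d R) ℂ) ⟨p, l⟩ c := by
  rw [map_mul, Submonoid.coe_mul, hΦ h, Matrix.mul_apply, Fintype.sum_sigma,
    Finset.sum_eq_single p]
  · simp [Matrix.blockDiagonal'_apply_eq]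
  · intro q _ hq
    exact Finset.sum_eq_zero fun l _ => by rw [Matrix.blockDiagonal'_apply_ne _ _ _ hq.symm, zero_mul]
  · simp

theorem IsPRIR.mul_apply (hΦ : IsPRIR H χ Φ) (h : H) (g : G) (p : Σ α, R α) (k : Fin (d p.1))
    (a : PRIRIndex d R) :
    (Φ (g * h) : Matrix (PRIRIndex d R) (PRIRIndex d R) ℂ) a ⟨p, k⟩ =
      ∑ l, (Φ g : Matrix (PRIRIndex d R) (PRIRIndex d R) ℂ) a ⟨p, l⟩ *
        (χ p.1 h : Matrix _ _ ℂ) l k := by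
  rw [map_mul, Submonoid.coe_mul, hΦ h, Matrix.mul_apply, Fintype.sum_sigma,
    Finset.sum_eq_single p]
  · simp [Matrix.blockDiagonal'_apply_eq]
  · intro q _ hq
    exact Finset.sum_eq_zero fun l _ => by rw [Matrix.blockDiagonal'_apply_ne _ _ _ hq, mul_zero]
  · simp

/-- Since `(h * g)⁻¹ = g⁻¹ * h⁻¹`, the row vector `x` is multiplied by `χ β h⁻¹` and the column
vector `y` by `χ β h`. The sum over `k` is their dot product, in which these factors cancel; the
copies `p` and `q` may differ, but both must be of type `β`. -/
theorem IsPRIR.sum_mul_left_invariant {R' : A → Type*} [∀ α, Fintype (R' α)]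
    [∀ α, DecidableEq (R' α)] {Ψ : G →* Matrix.unitaryGroup (PRIRIndex d R') ℂ}
    (hΦ : IsPRIR H χ Φ) (hΨ : IsPRIR H χ Ψ) {β : A} (p : R β) (q : R' β)
    (a : PRIRIndex d R) (c : PRIRIndex d R') (h : H) (g : G) :
    ∑ k : Fin (d β),
        (Φ (h * g)⁻¹ : Matrix (PRIRIndex d R) (PRIRIndex d R) ℂ) a ⟨⟨β, p⟩, k⟩ *
        (Ψ (h * g) : Matrix (PRIRIndex d R') (PRIRIndex d R') ℂ) ⟨⟨β, q⟩, k⟩ c =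
      ∑ k : Fin (d β),
        (Φ g⁻¹ : Matrix (PRIRIndex d R) (PRIRIndex d R) ℂ) a ⟨⟨β, p⟩, k⟩ *
        (Ψ g : Matrix (PRIRIndex d R') (PRIRIndex d R') ℂ) ⟨⟨β, q⟩, k⟩ c := by
  let x : Fin (d β) → ℂ := fun k =>
    (Φ g⁻¹ : Matrix (PRIRIndex d R) (PRIRIndex d R) ℂ) a ⟨⟨β, p⟩, k⟩
  let y : Fin (d β) → ℂ := fun k =>
    (Ψ g : Matrix (PRIRIndex d R') (PRIRIndex d R') ℂ) ⟨⟨β, q⟩, k⟩ c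
  have hx : ∀ k : Fin (d β), (Φ (h * g)⁻¹ : Matrix (PRIRIndex d R) (PRIRIndex d R) ℂ) a
      ⟨⟨β, p⟩, k⟩ = Matrix.vecMul x (χ β h⁻¹ : Matrix _ _ ℂ) k := fun k => by
    rw [mul_inv_rev, ← Subgroup.coe_inv]
    exact hΦ.mul_apply h⁻¹ g⁻¹ ⟨β, p⟩ k a
  have hy : ∀ k : Fin (d β), (Ψ (h * g) : Matrix (PRIRIndex d R') (PRIRIndex d R') ℂ)
      ⟨⟨β, q⟩, k⟩ c = Matrix.mulVec (χ β h : Matrix _ _ ℂ) y k := fun k =>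
    hΨ.apply_mul h g ⟨β, q⟩ k c
  simp only [hx, hy]
  change Matrix.vecMul x _ ⬝ᵥ Matrix.mulVec _ y = x ⬝ᵥ y
  rw [Matrix.dotProduct_mulVec, Matrix.vecMul_vecMul, ← Submonoid.coe_mul, ← map_mul,
    inv_mul_cancel, map_one, Submonoid.coe_one, Matrix.vecMul_one]

end PRIR

/-- Summed orthogonality over a right transversal of a subgroup, for irreps of a finite group in
partially reduced form. -/
theorem IsIrrepFamily.sum_transversal {G : Type*} [Group G] [Fintype G] {H : Subgroup G}
    {A : Type*} [Fintype A] [DecidableEq A] {d : A → ℕ}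
    {χ : ∀ α, H →* Matrix.unitaryGroup (Fin (d α)) ℂ}
    {M : Type*} [DecidableEq M] {R : M → A → Type*}
    [∀ μ α, Fintype (R μ α)] [∀ μ α, DecidableEq (R μ α)]
    {φ : ∀ μ, G →* Matrix.unitaryGroup (PRIRIndex d (R μ)) ℂ}
    (hφ : IsIrrepFamily φ) (hPRIR : ∀ μ, IsPRIR H χ (φ μ)) {T : Finset G}
    (hT : Subgroup.IsComplement (H : Set G) (T : Set G)) {μ ν : M} {β : A}
    (p : R μ β) (q : R ν β) (a : PRIRIndex d (R μ)) (c : PRIRIndex d (R ν)) :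
    ∑ τ ∈ T, ∑ k : Fin (d β),
        (φ μ τ⁻¹ : Matrix (PRIRIndex d (R μ)) (PRIRIndex d (R μ)) ℂ) a ⟨⟨β, p⟩, k⟩ *
        (φ ν τ : Matrix (PRIRIndex d (R ν)) (PRIRIndex d (R ν)) ℂ) ⟨⟨β, q⟩, k⟩ c =
      (Fintype.card G : ℂ) / (Nat.card H : ℂ) *
        ((d β : ℂ) / (Fintype.card (PRIRIndex d (R μ)) : ℂ)) *
        (if (⟨μ, β, p⟩ : Σ μ, Σ α, R μ α) = ⟨ν, β, q⟩ then 1 else 0) *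
        (if (⟨μ, a⟩ : Σ μ, PRIRIndex d (R μ)) = ⟨ν, c⟩ then 1 else 0) := by
  have hH : (Nat.card H : ℂ) ≠ 0 := Nat.cast_ne_zero.2 Nat.card_pos.ne'
  apply mul_left_cancel₀ hH
  rw [hT.card_mul_sum fun h hh g =>
    (hPRIR μ).sum_mul_left_invariant (hPRIR ν) p q a c ⟨h, hh⟩ g, Finset.sum_comm]
  -- The Kronecker delta of the inner indices does not depend on `k`, so the sum over `k` is `d β`
  -- equal terms.
  have hiff : ∀ k : Fin (d β), ((⟨μ, ⟨⟨β, p⟩, k⟩⟩ : Σ μ, PRIRIndex d (R μ)) = ⟨ν, ⟨⟨β, q⟩, k⟩⟩) ↔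
      ((⟨μ, β, p⟩ : Σ μ, Σ α, R μ α) = ⟨ν, β, q⟩) := by
    intro k
    by_cases h : μ = ν
    · subst h
      simp
    · simp [h]
  simp only [hφ.sum_mul, hiff, Finset.sum_const, Finset.card_univ, Fintype.card_fin, nsmul_eq_mul]
  field_simp

theorem mainTheorem6 {n : ℕ} (H : Subgroup (Equiv.Perm (Fin n)))
    -- the irreps of `H`, with their dimensions
    {A : Type*} [Fintype A] [DecidableEq A] (d : A → ℕ)
    (χ : ∀ α, H →* Matrix.unitaryGroup (Fin (d α)) ℂ) (hχ : IsIrrepFamily χ)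
    -- the irreps of `S(n)`, in partially reduced form with respect to `H`
    {M : Type*} [DecidableEq M] (R : M → A → Type*)
    [∀ μ α, Fintype (R μ α)] [∀ μ α, DecidableEq (R μ α)]
    (φ : ∀ μ, Equiv.Perm (Fin n) →* Matrix.unitaryGroup (PRIRIndex d (R μ)) ℂ)
    (hφ : IsIrrepFamily φ) (hPRIR : ∀ μ, IsPRIR H χ (φ μ))
    (T : Finset (Equiv.Perm (Fin n)))
    (μ ν : M) (α β γ : A)
    (r : R μ α) (r' : R μ β) (s : R ν β) (s' : R ν γ) (i : Fin (d α)) (j : Fin (d γ)) :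
    -- `S(n)` is the disjoint union of the cosets `H τ`, `τ ∈ T`
    (Subgroup.IsComplement (H : Set (Equiv.Perm (Fin n))) (T : Set (Equiv.Perm (Fin n))) →
      ∑ τ ∈ T, ∑ k : Fin (d β),
          (φ μ τ⁻¹ : Matrix (PRIRIndex d (R μ)) (PRIRIndex d (R μ)) ℂ) ⟨⟨α, r⟩, i⟩ ⟨⟨β, r'⟩, k⟩ *
          (φ ν τ : Matrix (PRIRIndex d (R ν)) (PRIRIndex d (R ν)) ℂ) ⟨⟨β, s⟩, k⟩ ⟨⟨γ, s'⟩, j⟩ =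
        (n.factorial : ℂ) / (Nat.card H : ℂ) *
          ((d β : ℂ) / (Fintype.card (PRIRIndex d (R μ)) : ℂ)) *
          (if (⟨μ, β, r'⟩ : Σ μ, Σ α, R μ α) = ⟨ν, β, s⟩ then 1 else 0) *
          (if (⟨μ, ⟨α, r⟩, i⟩ : Σ μ, PRIRIndex d (R μ)) = ⟨ν, ⟨γ, s'⟩, j⟩ then 1 else 0)) ∧
    -- `S(n)` is the disjoint union of the cosets `τ H`, `τ ∈ T`
    (Subgroup.IsComplement (T : Set (Equiv.Perm (Fin n))) (H : Set (Equiv.Perm (Fin n))) →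
      ∑ τ ∈ T, ∑ k : Fin (d β),
          (φ μ τ : Matrix (PRIRIndex d (R μ)) (PRIRIndex d (R μ)) ℂ) ⟨⟨α, r⟩, i⟩ ⟨⟨β, r'⟩, k⟩ *
          (φ ν τ⁻¹ : Matrix (PRIRIndex d (R ν)) (PRIRIndex d (R ν)) ℂ) ⟨⟨β, s⟩, k⟩ ⟨⟨γ, s'⟩, j⟩ =
        (n.factorial : ℂ) / (Nat.card H : ℂ) *
          ((d β : ℂ) / (Fintype.card (PRIRIndex d (R μ)) : ℂ)) *
          (if (⟨μ, β, r'⟩ : Σ μ, Σ α, R μ α) = ⟨ν, β, s⟩ then 1 else 0) *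
          (if (⟨μ, ⟨α, r⟩, i⟩ : Σ μ, PRIRIndex d (R μ)) = ⟨ν, ⟨γ, s'⟩, j⟩ then 1 else 0)) := by
  have hn : (n.factorial : ℂ) = (Fintype.card (Equiv.Perm (Fin n)) : ℂ) := by
    rw [Fintype.card_perm, Fintype.card_fin]
  rw [hn]
  refine ⟨fun hT => hφ.sum_transversal hPRIR hT r' s _ _, fun hT => ?_⟩
  -- Inversion turns `τ H` into `H τ⁻¹`, so the inverses of `T` form a transversal of the first
  -- kind.
  have hT' : Subgroup.IsComplement (H : Set (Equiv.Perm (Fin n)))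
      ((T.map (Equiv.inv _).toEmbedding : Finset (Equiv.Perm (Fin n))) :
        Set (Equiv.Perm (Fin n))) := by
    have h := hT.inv
    rw [inv_coe_set] at h
    convert h using 1
    ext x
    simp
  rw [← hφ.sum_transversal hPRIR hT' r' s ⟨⟨α, r⟩, i⟩ ⟨⟨γ, s'⟩, j⟩, Finset.sum_map]
  simp
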